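/- Let $G$ be a finite group. For $a,b\in G$ write $[a,b]=a^{-1}b^{-1}ab$, and let $|a|$ denote the order of $a$. The $\gamma^*_k$-commutators of $G$ ($k\ge 1$) are defined inductively: every element of $G$ is a $\gamma^*_1$-commutator, and for $k\ge 2$ an element $g\in G$ is a $\gamma^*_k$-commutator if $g=[a,b]$ for some power $a$ of a $\gamma^*_{k-1}$-commutator and some $b\in G$ with $\gcd(|a|,|b|)=1$. Let $\gamma^*_k(G)$ be the subgroup of $G$ generated by all $\gamma^*_k$-commutators. **Proposition.** Let $G$ be a finite soluble group and let $k\ge 2$ be such that $|ab|=|a||b|$ whenever $a$ and $b$ are $\gamma^*_k$-commutators of $G$ with $\gcd(|a|,|b|)=1$. Then $\gamma^*_k(G)$ is nilpotent. Moreover, $G$ is metanilpotent, that is, $G$ has a nilpotent normal subgroup $N$ with $G/N$ nilpotent; equivalently, the Fitting height of $G$ is at most $2$. Here the Fitting height is the least $t\ge 0$ with $F_t(G)=G$, where $F_0(G)=1$ and $F_{i+1}(G)/F_i(G)$ is the Fitting subgroup of $G/F_i(G)$, the subgroup generated by its nilpotent normal subgroups. -/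

import Mathlib

/-- `IsGammaStarCommutator k g`: the element `g` is a `γ*_k`-commutator (`k ≥ 1`). Every element is
a `γ*_1`-commutator; for `k ≥ 2` the `γ*_k`-commutators are the elements `[a, b] = a⁻¹ b⁻¹ a b`,
where `a` is a power of a `γ*_{k-1}`-commutator, `b` is arbitrary, and `a`, `b` have coprime orders.
The index `0` is not used; it gets the value of the index `1`. -/
def IsGammaStarCommutator {G : Type*} [Group G] : ℕ → G → Prop
  | 0, _ => True
  | 1, _ => True
  | k + 2, g => ∃ x a b : G, IsGammaStarCommutator (k + 1) x ∧ a ∈ Subgroup.zpowers x ∧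
      (orderOf a).Coprime (orderOf b) ∧ g = a⁻¹ * b⁻¹ * a * b

/-- The subgroup `γ*_k(G)` generated by all `γ*_k`-commutators of `G`. -/
def gammaStar (G : Type*) [Group G] (k : ℕ) : Subgroup G :=
  Subgroup.closure {g : G | IsGammaStarCommutator k g}

/-- A group is metanilpotent if it is an extension of a nilpotent group by a nilpotent group. -/
def IsMetanilpotent (G : Type*) [Group G] : Prop :=
  ∃ (N : Subgroup G) (_ : N.Normal), Group.IsNilpotent N ∧ Group.IsNilpotent (G ⧸ N)

/-- The Fitting subgroup `F(G)`, generated by all nilpotent normal subgroups of `G`. -/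
def fittingSubgroup (G : Type*) [Group G] : Subgroup G :=
  sSup {N : Subgroup G | N.Normal ∧ Group.IsNilpotent N}

theorem fittingSubgroup_normal (G : Type*) [Group G] : (fittingSubgroup G).Normal :=
  Subgroup.sSup_normal _ fun _ hN => hN.1

/-- The upper Fitting series, together with the normality of its terms: `F_0(G) = 1`, and
`F_{i+1}(G)` is the full preimage in `G` of `F(G / F_i(G))`. -/
def upperFittingSeriesAux (G : Type*) [Group G] : ℕ → {H : Subgroup G // H.Normal}
  | 0 => ⟨⊥, inferInstance⟩
  | i + 1 =>
    let H := upperFittingSeriesAux G i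
    haveI : H.1.Normal := H.2
    haveI : (fittingSubgroup (G ⧸ H.1)).Normal := fittingSubgroup_normal _
    ⟨(fittingSubgroup (G ⧸ H.1)).comap (QuotientGroup.mk' H.1), inferInstance⟩

/-- The term `F_i(G)` of the upper Fitting series of `G`. -/
def upperFittingSeries (G : Type*) [Group G] (i : ℕ) : Subgroup G :=
  (upperFittingSeriesAux G i).1

/-- The Fitting height: the least `t` with `F_t(G) = G` (it is `⊤` if there is no such `t`). -/
noncomputable def fittingHeight (G : Type*) [Group G] : ℕ∞ :=
  ⨅ (t : ℕ) (_ : upperFittingSeries G t = ⊤), (t : ℕ∞)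

/-!
Let `a` lie in a `q`-subgroup `Q` and let `b` be a `q'`-element normalizing `Q`. The Engel
commutator `x = [a, b, …, b]` with `k - 1` entries `b` is a `γ*_k`-commutator, and it lifts along
surjections, because Sylow subgroups and their normalizers do.

Let `W` be an `r`-subgroup with `r ≠ q` that `x` normalizes. For `w ∈ W` the product
`[w, x⁻¹, …, x⁻¹] * x` of two `γ*_k`-commutators is conjugate to `x`, so multiplicativity of the
orders forces `[w, x⁻¹, …, x⁻¹] = 1`, and by coprimeness `x` centralizes `W`. By lifting, in every
quotient of `G` the image of `x` centralizes all normal `r`-subgroups, `r ≠ q`. In `G / O_q(G)` it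
therefore centralizes the Fitting subgroup, which contains its own centralizer; so the image of `x`
lies in `O_q(G / O_q(G)) = 1`, that is, `x ∈ O_q(G) ≤ F(G)`.

Hence all Engel commutators of this kind are trivial in `G / F(G)`, i.e. coprime actions inside
`G / F(G)` are trivial, which for a soluble group means nilpotency. Finally `γ*_k` vanishes in a
nilpotent group, so `γ*_k(G) ≤ F(G)`.
-/

/-- The commutator `[a, b] = a⁻¹ b⁻¹ a b` as a function of `a`, so that its iterates are the Engel
commutators `[a, b, …, b]`. Mathlib's `⁅a, b⁆` is `a b a⁻¹ b⁻¹` instead. -/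
def commRight {G : Type*} [Group G] (b a : G) : G := a⁻¹ * b⁻¹ * a * b

section CommRight

variable {G H : Type*} [Group G] [Group H]

theorem commRight_eq_one_iff {a b : G} : commRight b a = 1 ↔ Commute a b := by
  rw [← Commute.inv_inv_iff, ← commutatorElement_eq_one_iff_commute, commutatorElement_def,
    inv_inv, inv_inv, commRight]

theorem semiconj_map_commRight (f : G →* H) (b : G) :
    Function.Semiconj f (commRight b) (commRight (f b)) := fun a => by
  simp only [commRight, map_mul, map_inv]

theorem commRight_mem {K : Subgroup G} {a b : G} (hb : b ∈ Subgroup.normalizer (K : Set G))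
    (ha : a ∈ K) : commRight b a ∈ K := by
  have hconj : b⁻¹ * a * b ∈ K := (Subgroup.mem_normalizer_iff''.1 hb a).1 ha
  simpa only [commRight, mul_assoc] using K.mul_mem (K.inv_mem ha) hconj

theorem commRight_iterate_mem {K : Subgroup G} {a b : G}
    (hb : b ∈ Subgroup.normalizer (K : Set G)) (ha : a ∈ K) (m : ℕ) :
    (commRight b)^[m] a ∈ K :=
  Set.MapsTo.iterate (fun _ => commRight_mem hb) m ha

theorem orderOf_commRight_mul_inv (a b : G) : orderOf (commRight b a * b⁻¹) = orderOf b := by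
  have hconj : commRight b a * b⁻¹ = MulAut.conj a⁻¹ b⁻¹ := by simp [commRight]
  rw [hconj, MulEquiv.orderOf_eq, orderOf_inv]

theorem commRight_eq_one_of_orderOf_mul {a b : G}
    (hco : (orderOf (commRight b a)).Coprime (orderOf b))
    (hmul : orderOf (commRight b a * b⁻¹) = orderOf (commRight b a) * orderOf b) :
    commRight b a = 1 := by
  rw [orderOf_commRight_mul_inv] at hmul
  rw [← orderOf_eq_one_iff]
  rcases (orderOf b).eq_zero_or_pos with hb | hb
  · rwa [hb, Nat.coprime_zero_right] at hco
  · exact Nat.eq_of_mul_eq_mul_right hb (by rw [← hmul, one_mul])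

theorem commRight_eq_one_of_commute {a b : G}
    (hco : (orderOf (commRight b a)).Coprime (orderOf b)) (h : Commute (commRight b a) b) :
    commRight b a = 1 := by
  refine commRight_eq_one_of_orderOf_mul hco ?_
  rw [h.inv_right.orderOf_mul_eq_mul_orderOf_of_coprime (by rwa [orderOf_inv]), orderOf_inv]

theorem commute_of_commRight_iterate_eq_one {K : Subgroup G} {a b : G}
    (hb : b ∈ Subgroup.normalizer (K : Set G)) (hco : ∀ x ∈ K, (orderOf x).Coprime (orderOf b))
    (ha : a ∈ K) {m : ℕ} (h : (commRight b)^[m + 1] a = 1) : Commute a b := by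
  induction m with
  | zero => exact commRight_eq_one_iff.1 h
  | succ m ih =>
    rw [Function.iterate_succ_apply', commRight_eq_one_iff] at h
    rw [Function.iterate_succ_apply'] at h ih
    exact ih (commRight_eq_one_of_commute
      (hco _ (commRight_mem hb (commRight_iterate_mem hb ha m))) h)

end CommRight

theorem commute_of_coprime_orderOf {G : Type*} [Group G] [Group.IsNilpotent G] {a b : G}
    (h : (orderOf a).Coprime (orderOf b)) : Commute a b := by
  refine Group.nilpotent_center_quotient_ind
    (P := fun G _ _ => ∀ a b : G, (orderOf a).Coprime (orderOf b) → Commute a b) G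
    (fun _ _ _ _ _ _ => Subsingleton.elim _ _) (fun G _ _ ih a b h => ?_) a b h
  set c := commRight b a with hc
  have hcenter : c ∈ Subgroup.center G := by
    have hcomm : Commute (a : G ⧸ Subgroup.center G) b :=
      ih _ _ ((h.coprime_dvd_left (orderOf_map_dvd (QuotientGroup.mk' _) a)).coprime_dvd_right
        (orderOf_map_dvd (QuotientGroup.mk' _) b))
    exact (QuotientGroup.eq_one_iff _).1 (commRight_eq_one_iff.2 hcomm)
  have hcomm (x : G) : Commute c x := (Subgroup.mem_center_iff.1 hcenter x).symm
  have hdvd : orderOf c ∣ orderOf a := by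
    have hconj : a * c = MulAut.conj b⁻¹ a := by simp [hc, commRight, mul_assoc]
    apply orderOf_dvd_of_pow_eq_one
    calc c ^ orderOf a = (a * c) ^ orderOf a := by
          rw [(hcomm a).symm.mul_pow, pow_orderOf_eq_one, one_mul]
      _ = 1 := by rw [hconj, ← map_pow, pow_orderOf_eq_one, map_one]
  exact commRight_eq_one_iff.1 (commRight_eq_one_of_commute (h.coprime_dvd_left hdvd) (hcomm b))

section GammaStar

variable {G H : Type*} [Group G] [Group H]

theorem IsGammaStarCommutator.map (f : G →* H) :
    ∀ {k : ℕ} {g : G}, IsGammaStarCommutator k g → IsGammaStarCommutator k (f g)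
  | 0, _, _ => trivial
  | 1, _, _ => trivial
  | _ + 2, _, ⟨x, a, b, hx, ha, hco, hg⟩ =>
    ⟨f x, f a, f b, hx.map f, f.map_zpowers x ▸ Subgroup.mem_map_of_mem f ha,
      (hco.coprime_dvd_left (orderOf_map_dvd f a)).coprime_dvd_right (orderOf_map_dvd f b),
      by simp only [hg, map_mul, map_inv]⟩

theorem isGammaStarCommutator_commRight_iterate {K : Subgroup G} {a b : G}
    (hb : b ∈ Subgroup.normalizer (K : Set G)) (hco : ∀ x ∈ K, (orderOf x).Coprime (orderOf b))
    (ha : a ∈ K) (m : ℕ) : IsGammaStarCommutator (m + 1) ((commRight b)^[m] a) := by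
  induction m with
  | zero => trivial
  | succ m ih =>
    rw [Function.iterate_succ_apply']
    exact ⟨_, _, b, ih, Subgroup.mem_zpowers _, hco _ (commRight_iterate_mem hb ha m), rfl⟩

theorem gammaStar_le_of_isNilpotent_quotient (N : Subgroup G) [N.Normal]
    [Group.IsNilpotent (G ⧸ N)] (k : ℕ) : gammaStar G (k + 2) ≤ N := by
  rw [gammaStar, Subgroup.closure_le]
  rintro _ ⟨-, a, b, -, -, hco, rfl⟩
  have hcomm : Commute (a : G ⧸ N) b := commute_of_coprime_orderOf
    ((hco.coprime_dvd_left (orderOf_map_dvd (QuotientGroup.mk' N) a)).coprime_dvd_right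
      (orderOf_map_dvd (QuotientGroup.mk' N) b))
  exact (QuotientGroup.eq_one_iff _).1 (commRight_eq_one_iff.2 hcomm)

end GammaStar

/-- Orders of `γ*_k`-commutators of coprime orders multiply: the hypothesis on `G` in the
proposition. -/
def GammaStarOrdersMultiply (k : ℕ) (G : Type*) [Group G] : Prop :=
  ∀ a b : G, IsGammaStarCommutator k a → IsGammaStarCommutator k b →
    (orderOf a).Coprime (orderOf b) → orderOf (a * b) = orderOf a * orderOf b

namespace GammaStarOrdersMultiply

variable {G : Type*} [Group G] {k : ℕ}

theorem mem_centralizer (h : GammaStarOrdersMultiply (k + 2) G) {W : Subgroup G} {x : G}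
    (hx : IsGammaStarCommutator (k + 2) x) (hxW : x ∈ Subgroup.normalizer (W : Set G))
    (hco : ∀ w ∈ W, (orderOf w).Coprime (orderOf x)) :
    x ∈ Subgroup.centralizer (W : Set G) := by
  rw [Subgroup.mem_centralizer_iff]
  intro w hw
  have hxW' : x⁻¹ ∈ Subgroup.normalizer (W : Set G) := inv_mem hxW
  simp only [← orderOf_inv x] at hco
  -- `[w, x⁻¹, …, x⁻¹] * x` is a conjugate of `x`, which forces the first factor to have order `1`.
  have hEngel : (commRight x⁻¹)^[k + 1] w = 1 := by
    have hγ := isGammaStarCommutator_commRight_iterate hxW' hco hw (k + 1)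
    have hcoEngel := hco _ (commRight_iterate_mem hxW' hw (k + 1))
    rw [Function.iterate_succ_apply'] at hγ hcoEngel ⊢
    refine commRight_eq_one_of_orderOf_mul hcoEngel ?_
    rw [inv_inv, orderOf_inv]
    exact h _ _ hγ hx (by rwa [orderOf_inv] at hcoEngel)
  exact (Commute.inv_right_iff.1 (commute_of_commRight_iterate_eq_one hxW' hco hw hEngel)).eq

end GammaStarOrdersMultiply

section Lifting

variable {G H : Type*} [Group G] [Group H]

theorem exists_isPGroup_map_eq_of_normal [Finite G] {f : G →* H} (hf : Function.Surjective f)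
    {q : ℕ} [Fact q.Prime] {Q : Subgroup H} [Q.Normal] (hQ : IsPGroup q Q) :
    ∃ R : Subgroup G, IsPGroup q R ∧ R.map f = Q ∧
      (Subgroup.normalizer (R : Set G)).map f = ⊤ := by
  set L : Subgroup G := Q.comap f
  obtain ⟨S⟩ : Nonempty (Sylow q L) := inferInstance
  have hfL := f.subgroupComap_surjective_of_surjective Q hf
  have hS : (S : Subgroup L).map (f.subgroupComap Q) = ⊤ :=
    ((S.mapSurjective hfL).is_maximal' (hQ.to_subgroup ⊤) le_top).symm
  have hRQ : ((S : Subgroup L).map L.subtype).map f = Q := by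
    calc ((S : Subgroup L).map L.subtype).map f
        = ((S : Subgroup L).map (f.subgroupComap Q)).map Q.subtype := by
          rw [Subgroup.map_map, Subgroup.map_map]; rfl
      _ = Q := by rw [hS, ← MonoidHom.range_eq_map, Q.range_subtype]
  refine ⟨(S : Subgroup L).map L.subtype, S.isPGroup'.map _, hRQ, ?_⟩
  have hLle : L.map f ≤ (Subgroup.normalizer
      ((S : Subgroup L).map L.subtype : Set G)).map f :=
    (Subgroup.map_comap_le f Q).trans (hRQ.ge.trans (Subgroup.map_mono Subgroup.le_normalizer))
  rw [← sup_eq_left.2 hLle, ← Subgroup.map_sup, S.normalizer_sup_eq_top,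
    Subgroup.map_top_of_surjective f hf]

theorem exists_isPGroup_map_eq [Finite G] {f : G →* H} (hf : Function.Surjective f)
    {q : ℕ} [Fact q.Prime] {Q : Subgroup H} (hQ : IsPGroup q Q) :
    ∃ R : Subgroup G, IsPGroup q R ∧ R.map f = Q ∧
      Subgroup.normalizer (Q : Set H) ≤ (Subgroup.normalizer (R : Set G)).map f := by
  set N : Subgroup H := Subgroup.normalizer (Q : Set H)
  have hQN : (Q.subgroupOf N).map N.subtype = Q :=
    Subgroup.map_subgroupOf_eq_of_le Subgroup.le_normalizer
  have hcomm : f.comp (N.comap f).subtype = N.subtype.comp (f.subgroupComap N) := rfl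
  have : (Q.subgroupOf N).Normal := Subgroup.normal_in_normalizer
  obtain ⟨R, hR, hRQ, hRN⟩ := exists_isPGroup_map_eq_of_normal
    (f.subgroupComap_surjective_of_surjective N hf) (Q := Q.subgroupOf N) hQ.comap_subtype
  refine ⟨R.map (N.comap f).subtype, hR.map _, ?_, ?_⟩
  · rw [Subgroup.map_map, hcomm, ← Subgroup.map_map, hRQ, hQN]
  · calc N = ((Subgroup.normalizer (R : Set (N.comap f))).map (f.subgroupComap N)).map
          N.subtype := by rw [hRN, ← MonoidHom.range_eq_map, N.range_subtype]
      _ = ((Subgroup.normalizer (R : Set (N.comap f))).map (N.comap f).subtype).map f := by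
          rw [Subgroup.map_map, Subgroup.map_map, hcomm]
      _ ≤ _ := Subgroup.map_mono (Subgroup.le_normalizer_map _)

theorem exists_coprime_orderOf_pow_prime_pow {g : G} (hg : IsOfFinOrder g) {p : ℕ}
    (hp : p.Prime) : ∃ n : ℕ, (orderOf (g ^ p ^ n)).Coprime p := by
  obtain ⟨n, l, hl, hgl⟩ := Nat.exists_eq_pow_mul_and_not_dvd hg.orderOf_pos.ne' p hp.ne_one
  refine ⟨n, Nat.Coprime.coprime_dvd_left (orderOf_dvd_of_pow_eq_one ?_)
    (hp.coprime_iff_not_dvd.2 hl).symm⟩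
  rw [← pow_mul, ← hgl, pow_orderOf_eq_one]

theorem exists_mem_zpowers_map_eq_of_coprime (f : G →* H) {p : ℕ} (hp : p.Prime) {g : G}
    (hg : IsOfFinOrder g) (hco : (orderOf (f g)).Coprime p) :
    ∃ c ∈ Subgroup.zpowers g, f c = f g ∧ (orderOf c).Coprime p := by
  obtain ⟨n, hn⟩ := exists_coprime_orderOf_pow_prime_pow hg hp
  obtain ⟨j, hj⟩ := exists_pow_eq_self_of_coprime (hco.pow_right n).symm
  exact ⟨(g ^ p ^ n) ^ j, Subgroup.pow_mem _ (Subgroup.npow_mem_zpowers _ _) _,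
    by rwa [map_pow, map_pow], hn.coprime_dvd_left (orderOf_pow_dvd j)⟩

end Lifting

section Nilpotent

variable {G : Type*} [Group G]

theorem isNilpotent_of_le {H K : Subgroup G} [Group.IsNilpotent K] (h : H ≤ K) :
    Group.IsNilpotent H :=
  (Group.isNilpotent_congr (Subgroup.subgroupOfEquivOfLe h)).1 inferInstance

theorem isNilpotent_of_commutator_le_center (h : commutator G ≤ Subgroup.center G) :
    Group.IsNilpotent G :=
  Subgroup.isNilpotent_of_ker_le_center Abelianization.of (by rwa [Abelianization.ker_of])

theorem isNilpotent_quotient_mono {N K : Subgroup G} [N.Normal] [K.Normal] (h : N ≤ K)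
    [Group.IsNilpotent (G ⧸ N)] : Group.IsNilpotent (G ⧸ K) :=
  Group.nilpotent_of_surjective (QuotientGroup.map N K (MonoidHom.id G) h)
    (QuotientGroup.map_surjective_of_surjective N K (MonoidHom.id G)
      (QuotientGroup.mk'_surjective K) h)

end Nilpotent

/-- `O_p(G)`, the largest normal `p`-subgroup of `G`. -/
def pCore (p : ℕ) (G : Type*) [Group G] : Subgroup G :=
  sSup {P : Subgroup G | P.Normal ∧ IsPGroup p P}

section PCore

variable {G : Type*} [Group G] {p : ℕ}

instance pCore_normal : (pCore p G).Normal :=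
  Subgroup.sSup_normal _ fun _ hP => hP.1

theorem isPGroup_pCore : IsPGroup p (pCore p G) :=
  Sylow.sSup_of_normal _ (fun _ hP => hP.2) fun _ hP => hP.1

theorem le_pCore {P : Subgroup G} [hn : P.Normal] (hP : IsPGroup p P) : P ≤ pCore p G :=
  le_sSup ⟨hn, hP⟩

theorem pCore_quotient_pCore : pCore p (G ⧸ pCore p G) = ⊥ := by
  have hle : (pCore p (G ⧸ pCore p G)).comap (QuotientGroup.mk' (pCore p G)) ≤ pCore p G :=
    le_pCore (isPGroup_pCore.comap_of_ker_isPGroup _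
      (by rw [QuotientGroup.ker_mk']; exact isPGroup_pCore))
  rw [eq_bot_iff, ← QuotientGroup.map_mk'_self (pCore p G)]
  exact (Subgroup.map_comap_eq_self_of_surjective (QuotientGroup.mk'_surjective _) _).ge.trans
    (Subgroup.map_mono hle)

theorem map_subtype_le_pCore {N : Subgroup G} [N.Normal] [Finite N] [Group.IsNilpotent N]
    [Fact p.Prime] {P : Subgroup N} (hP : IsPGroup p P) : P.map N.subtype ≤ pCore p G := by
  obtain ⟨S, hPS⟩ := hP.exists_le_sylow
  have : (S : Subgroup N).Characteristic := S.characteristic_of_normal inferInstance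
  exact (Subgroup.map_mono hPS).trans (le_pCore (S.isPGroup'.map N.subtype))

theorem le_pCore_of_le_isNilpotent {N P : Subgroup G} [N.Normal] [Finite N]
    [Group.IsNilpotent N] [Fact p.Prime] (hPN : P ≤ N) (hP : IsPGroup p P) : P ≤ pCore p G := by
  rw [← Subgroup.map_subgroupOf_eq_of_le hPN]
  exact map_subtype_le_pCore hP.comap_subtype

end PCore

theorem eq_top_of_forall_exists_sylow_le {G : Type*} [Group G] [Finite G] {K : Subgroup G}
    (h : ∀ p ∈ (Nat.card G).primeFactors, ∃ P : Sylow p G, (P : Subgroup G) ≤ K) : K = ⊤ := by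
  rw [← Subgroup.index_eq_one, Nat.eq_one_iff_not_exists_prime_dvd]
  intro p hp hpK
  have := Fact.mk hp
  obtain ⟨P, hPK⟩ := h p
    (Nat.mem_primeFactors.2 ⟨hp, hpK.trans K.index_dvd_card, Nat.card_pos.ne'⟩)
  exact P.not_dvd_index (hpK.trans (Subgroup.index_dvd_of_le hPK))

section Fitting

variable {G : Type*} [Group G]

instance : (fittingSubgroup G).Normal := fittingSubgroup_normal G

theorem le_fittingSubgroup {N : Subgroup G} [hn : N.Normal] [hN : Group.IsNilpotent N] :
    N ≤ fittingSubgroup G :=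
  le_sSup ⟨hn, hN⟩

theorem fittingSubgroup_eq_top [Group.IsNilpotent G] : fittingSubgroup G = ⊤ :=
  top_le_iff.1 le_fittingSubgroup

theorem centralizer_fittingSubgroup_le [Group.IsSolvable G] :
    Subgroup.centralizer (fittingSubgroup G : Set G) ≤ fittingSubgroup G := by
  set F := fittingSubgroup G
  set C := Subgroup.centralizer (F : Set G)
  have hdescent (n : ℕ) : derivedSeries G n ⊓ C ≤ F → C ≤ F := by
    induction n with
    | zero => rw [derivedSeries_zero, top_inf_eq]; exact id
    | succ n ih =>
      intro hn
      set E := derivedSeries G n ⊓ C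
      have hcomm : ⁅E, E⁆ ≤ F := (le_inf (Subgroup.commutator_mono inf_le_left inf_le_left)
        (E.commutator_le_self.trans inf_le_right)).trans hn
      have : Group.IsNilpotent E := isNilpotent_of_commutator_le_center fun x hx =>
        have hxF : (x : G) ∈ F :=
          hcomm (E.map_subtype_commutator ▸ Subgroup.mem_map_of_mem E.subtype hx)
        Subgroup.mem_center_iff.2 fun g =>
          Subtype.ext (Subgroup.mem_centralizer_iff.1 g.2.2 x hxF).symm
      exact ih le_fittingSubgroup
  obtain ⟨n, hn⟩ := (Group.isSolvable_def G).1 ‹_›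
  exact hdescent n (by rw [hn, bot_inf_eq]; exact bot_le)

variable [Finite G]

theorem pCore_le_fittingSubgroup {p : ℕ} [Fact p.Prime] : pCore p G ≤ fittingSubgroup G :=
  have : Group.IsNilpotent (pCore p G) := isPGroup_pCore.isNilpotent
  le_fittingSubgroup

theorem fittingSubgroup_le_of_forall_pCore_le {K : Subgroup G}
    (h : ∀ p ∈ (Nat.card G).primeFactors, pCore p G ≤ K) : fittingSubgroup G ≤ K := by
  refine sSup_le fun N ⟨_, _⟩ => Subgroup.subgroupOf_eq_top.1 ?_
  refine eq_top_of_forall_exists_sylow_le fun p hp => ?_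
  have := Fact.mk (Nat.prime_of_mem_primeFactors hp)
  obtain ⟨P⟩ : Nonempty (Sylow p N) := inferInstance
  have hpG : p ∈ (Nat.card G).primeFactors :=
    Nat.primeFactors_mono N.card_subgroup_dvd_card Nat.card_pos.ne' hp
  exact ⟨P, Subgroup.map_le_iff_le_comap.1 ((map_subtype_le_pCore P.isPGroup').trans (h p hpG))⟩

instance isNilpotent_fittingSubgroup : Group.IsNilpotent (fittingSubgroup G) := by
  have hprime (p : (Nat.card G).primeFactors) : Fact (p : ℕ).Prime :=
    ⟨Nat.prime_of_mem_primeFactors p.2⟩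
  have (p : (Nat.card G).primeFactors) : Group.IsNilpotent (pCore p G) :=
    isPGroup_pCore.isNilpotent
  have hcomm : Pairwise fun p q : (Nat.card G).primeFactors =>
      ∀ x y : G, x ∈ pCore p G → y ∈ pCore q G → Commute x y := fun p q hpq =>
    Subgroup.commute_of_normal_of_disjoint _ _ inferInstance inferInstance
      (IsPGroup.disjoint_of_ne p q (Subtype.coe_ne_coe.2 hpq) _ _ isPGroup_pCore isPGroup_pCore)
  have : Group.IsNilpotent (Subgroup.noncommPiCoprod hcomm).range :=
    Group.nilpotent_of_surjective _ (Subgroup.noncommPiCoprod hcomm).rangeRestrict_surjective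
  refine isNilpotent_of_le (fittingSubgroup_le_of_forall_pCore_le (fun p hp => ?_) :
    _ ≤ (Subgroup.noncommPiCoprod hcomm).range)
  rw [Subgroup.noncommPiCoprod_range]
  exact le_iSup (fun p : (Nat.card G).primeFactors => pCore p G) ⟨p, hp⟩

end Fitting

section FittingHeight

variable {G : Type*} [Group G]

theorem le_upperFittingSeries_one (N : Subgroup G) [hN : N.Normal] [Group.IsNilpotent N] :
    N ≤ upperFittingSeries G 1 := by
  intro x hx
  have := hN.map (QuotientGroup.mk' (⊥ : Subgroup G)) (QuotientGroup.mk'_surjective ⊥)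
  have : Group.IsNilpotent (N.map (QuotientGroup.mk' (⊥ : Subgroup G))) :=
    Group.nilpotent_of_surjective _ (MonoidHom.subgroupMap_surjective _ N)
  have hmap : N.map (QuotientGroup.mk' ⊥) ≤ fittingSubgroup (G ⧸ (⊥ : Subgroup G)) :=
    le_fittingSubgroup
  exact hmap (Subgroup.mem_map_of_mem _ hx)

theorem IsMetanilpotent.fittingHeight_le_two (h : IsMetanilpotent G) : fittingHeight G ≤ 2 := by
  obtain ⟨N, _, _, _⟩ := h
  refine iInf₂_le_of_le 2 ?_ le_rfl
  have : (upperFittingSeriesAux G 1).1.Normal := (upperFittingSeriesAux G 1).2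
  have : Group.IsNilpotent (G ⧸ (upperFittingSeriesAux G 1).1) :=
    isNilpotent_quotient_mono (le_upperFittingSeries_one N)
  change (fittingSubgroup (G ⧸ (upperFittingSeriesAux G 1).1)).comap _ = ⊤
  rw [fittingSubgroup_eq_top, Subgroup.comap_top]

end FittingHeight

theorem coprime_orderOf_of_mem {G : Type*} [Group G] {Q : Subgroup G} {q n : ℕ}
    (hQ : IsPGroup q Q) (hn : n.Coprime q) {x : G} (hx : x ∈ Q) : (orderOf x).Coprime n := by
  rw [← Subgroup.orderOf_mk x hx]
  exact hQ.orderOf_coprime hn.symm _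

/-- `x` is an Engel commutator `[a, b, …, b]`, with `m` entries `b`, of an element `a` of a
`q`-subgroup `Q` and a `q'`-element `b` normalizing `Q`. Such commutators measure how far coprime
actions inside the group are from being trivial, and they lift along surjections. -/
def IsCoprimeEngelCommutator {G : Type*} [Group G] (m q : ℕ) (x : G) : Prop :=
  ∃ Q : Subgroup G, IsPGroup q Q ∧ ∃ a ∈ Q, ∃ b ∈ Subgroup.normalizer (Q : Set G),
    (orderOf b).Coprime q ∧ (commRight b)^[m] a = x

namespace IsCoprimeEngelCommutator

variable {G H : Type*} [Group G] [Group H] {m q : ℕ}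

theorem isPGroup_zpowers {x : G} (hx : IsCoprimeEngelCommutator m q x) :
    IsPGroup q (Subgroup.zpowers x) := by
  obtain ⟨Q, hQ, a, ha, b, hb, -, rfl⟩ := hx
  exact hQ.to_le (Subgroup.zpowers_le.2 (commRight_iterate_mem hb ha m))

theorem isGammaStarCommutator {x : G} (hx : IsCoprimeEngelCommutator m q x) :
    IsGammaStarCommutator (m + 1) x := by
  obtain ⟨Q, hQ, a, ha, b, hb, hbq, rfl⟩ := hx
  exact isGammaStarCommutator_commRight_iterate hb
    (fun _ => coprime_orderOf_of_mem hQ hbq) ha m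

theorem map (f : G →* H) {x : G} (hx : IsCoprimeEngelCommutator m q x) :
    IsCoprimeEngelCommutator m q (f x) := by
  obtain ⟨Q, hQ, a, ha, b, hb, hbq, rfl⟩ := hx
  exact ⟨Q.map f, hQ.map f, f a, Subgroup.mem_map_of_mem f ha, f b,
    Subgroup.le_normalizer_map f (Subgroup.mem_map_of_mem f hb),
    hbq.coprime_dvd_left (orderOf_map_dvd f b),
    ((semiconj_map_commRight f b).iterate_right m a).symm⟩

theorem exists_map_eq [Finite G] [Fact q.Prime] {f : G →* H} (hf : Function.Surjective f) {x : H}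
    (hx : IsCoprimeEngelCommutator m q x) : ∃ y : G, IsCoprimeEngelCommutator m q y ∧ f y = x := by
  obtain ⟨Q, hQ, _, ha, b, hb, hbq, rfl⟩ := hx
  obtain ⟨R, hR, rfl, hRN⟩ := exists_isPGroup_map_eq hf hQ
  obtain ⟨a, ha, rfl⟩ := ha
  obtain ⟨c, hc, rfl⟩ := hRN hb
  obtain ⟨d, hd, hdc, hdq⟩ :=
    exists_mem_zpowers_map_eq_of_coprime f Fact.out (isOfFinOrder_of_finite c) hbq
  refine ⟨_, ⟨R, hR, a, ha, d, Subgroup.zpowers_le.2 hc hd, hdq, rfl⟩, ?_⟩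
  rw [(semiconj_map_commRight f d).iterate_right m a, hdc]

end IsCoprimeEngelCommutator

namespace GammaStarOrdersMultiply

variable {G H : Type*} [Group G] [Group H] [Finite G] {m q : ℕ} [Fact q.Prime]

theorem mem_centralizer_of_surjective (h : GammaStarOrdersMultiply (m + 2) G) {f : G →* H}
    (hf : Function.Surjective f) {r : ℕ} [Fact r.Prime] (hqr : q ≠ r) {W : Subgroup H} [W.Normal]
    (hW : IsPGroup r W) {x : H} (hx : IsCoprimeEngelCommutator (m + 1) q x) :
    x ∈ Subgroup.centralizer (W : Set H) := by
  obtain ⟨R, hR, rfl, hRN⟩ := exists_isPGroup_map_eq_of_normal hf hW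
  set N : Subgroup G := Subgroup.normalizer (R : Set G)
  have hfN : Function.Surjective (f.comp N.subtype) := by
    rw [← MonoidHom.range_eq_top, MonoidHom.range_comp, N.range_subtype, hRN]
  obtain ⟨⟨y, hyN⟩, hy, rfl⟩ := hx.exists_map_eq hfN
  have hyG : IsCoprimeEngelCommutator (m + 1) q y := hy.map N.subtype
  have hyr : (orderOf y).Coprime r := coprime_orderOf_of_mem hyG.isPGroup_zpowers
    ((Nat.coprime_primes Fact.out Fact.out).2 hqr.symm) (Subgroup.mem_zpowers y)
  have hyR : y ∈ Subgroup.centralizer (R : Set G) := h.mem_centralizer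
    hyG.isGammaStarCommutator hyN fun _ => coprime_orderOf_of_mem hR hyr
  exact Subgroup.map_centralizer_le_centralizer_image (R : Set G) f
    (Subgroup.mem_map_of_mem f hyR)

variable [Group.IsSolvable G]

theorem mem_pCore (h : GammaStarOrdersMultiply (m + 2) G) {x : G}
    (hx : IsCoprimeEngelCommutator (m + 1) q x) : x ∈ pCore q G := by
  set f := QuotientGroup.mk' (pCore q G)
  have hf : Function.Surjective f := QuotientGroup.mk'_surjective _
  have hfx : IsCoprimeEngelCommutator (m + 1) q (f x) := hx.map f
  have hcentral : fittingSubgroup (G ⧸ pCore q G) ≤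
      Subgroup.centralizer (Subgroup.zpowers (f x) : Set (G ⧸ pCore q G)) := by
    refine fittingSubgroup_le_of_forall_pCore_le fun r hr => ?_
    have := Fact.mk (Nat.prime_of_mem_primeFactors hr)
    rcases eq_or_ne q r with rfl | hqr
    · exact pCore_quotient_pCore.trans_le bot_le
    · rw [Subgroup.le_centralizer_iff, Subgroup.zpowers_le]
      exact h.mem_centralizer_of_surjective hf hqr isPGroup_pCore hfx
  have hfitting : Subgroup.zpowers (f x) ≤ fittingSubgroup (G ⧸ pCore q G) :=
    (Subgroup.le_centralizer_iff.1 hcentral).trans centralizer_fittingSubgroup_le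
  have hcore : f x ∈ pCore q (G ⧸ pCore q G) :=
    le_pCore_of_le_isNilpotent hfitting hfx.isPGroup_zpowers (Subgroup.mem_zpowers _)
  rwa [pCore_quotient_pCore, Subgroup.mem_bot, QuotientGroup.mk'_apply,
    QuotientGroup.eq_one_iff] at hcore

theorem eq_one_of_quotient_fittingSubgroup (h : GammaStarOrdersMultiply (m + 2) G)
    {x : G ⧸ fittingSubgroup G} (hx : IsCoprimeEngelCommutator (m + 1) q x) : x = 1 := by
  obtain ⟨y, hy, rfl⟩ := hx.exists_map_eq (QuotientGroup.mk'_surjective (fittingSubgroup G))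
  exact (QuotientGroup.eq_one_iff y).2 (pCore_le_fittingSubgroup (h.mem_pCore hy))

end GammaStarOrdersMultiply

theorem center_ne_bot_of_forall_pow_mem_centralizer {G : Type*} [Group G] {p : ℕ}
    [Fact p.Prime] {V : Subgroup G} [V.Normal] [Finite V] (hV : IsPGroup p V) (hbot : V ≠ ⊥)
    (hpow : ∀ g : G, ∃ n : ℕ, g ^ p ^ n ∈ Subgroup.centralizer (V : Set G)) :
    Subgroup.center G ≠ ⊥ := by
  set φ : G →* MulAut V := MulAut.conjNormal
  have hφ : IsPGroup p φ.range := by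
    rintro ⟨_, g, rfl⟩
    obtain ⟨n, hn⟩ := hpow g
    refine ⟨n, Subtype.ext ((map_pow φ g (p ^ n)).symm.trans (MulEquiv.ext fun v => ?_))⟩
    refine Subtype.ext ?_
    rw [MulAut.conjNormal_apply, ← Subgroup.mem_centralizer_iff.1 hn v v.2, mul_inv_cancel_right]
    rfl
  have := V.nontrivial_iff_ne_bot.2 hbot
  have hpV : p ∣ Nat.card V :=
    hV.card_eq_or_dvd.resolve_left (Finite.one_lt_card (α := V)).ne'
  obtain ⟨v, hv, hv1⟩ := hφ.exists_fixed_point_of_prime_dvd_card_of_fixed_point V hpV (a := 1)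
    fun g => map_one (g : MulAut V)
  have hvZ : (v : G) ∈ Subgroup.center G := Subgroup.mem_center_iff.2 fun g => by
    have hgv : φ g v = v := hv ⟨φ g, g, rfl⟩
    rw [← mul_inv_eq_iff_eq_mul, ← MulAut.conjNormal_apply]
    exact congrArg Subtype.val hgv
  exact fun hZ => hv1 (Subtype.ext (Subgroup.mem_bot.1 (hZ ▸ hvZ)).symm)

section NilpotencyCriterion

variable {G : Type*} [Group G] [Finite G]

theorem exists_pCore_ne_bot [Group.IsSolvable G] [Nontrivial G] :
    ∃ p : ℕ, p.Prime ∧ pCore p G ≠ ⊥ := by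
  by_contra! hbot
  have hF : fittingSubgroup G = ⊥ := eq_bot_iff.2 <| fittingSubgroup_le_of_forall_pCore_le
    fun p hp => (hbot p (Nat.prime_of_mem_primeFactors hp)).le
  have htop : (⊤ : Subgroup G) ≤ ⊥ := calc
    ⊤ ≤ Subgroup.centralizer (fittingSubgroup G : Set G) :=
      Subgroup.le_centralizer_iff.2 (hF.trans_le bot_le)
    _ ≤ fittingSubgroup G := centralizer_fittingSubgroup_le
    _ = ⊥ := hF
  exact top_ne_bot (le_bot_iff.1 htop)

variable [Group.IsSolvable G] {m : ℕ}

theorem center_ne_bot_of_forall_isCoprimeEngelCommutator [Nontrivial G]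
    (h : ∀ q : ℕ, q.Prime → ∀ x : G, IsCoprimeEngelCommutator (m + 1) q x → x = 1) :
    Subgroup.center G ≠ ⊥ := by
  obtain ⟨p, hp, hbot⟩ := exists_pCore_ne_bot (G := G)
  have := Fact.mk hp
  refine center_ne_bot_of_forall_pow_mem_centralizer isPGroup_pCore hbot fun g => ?_
  obtain ⟨n, hn⟩ := exists_coprime_orderOf_pow_prime_pow (isOfFinOrder_of_finite g) hp
  have hnorm : g ^ p ^ n ∈ Subgroup.normalizer (pCore p G : Set G) :=
    (Subgroup.normalizer_eq_top (H := pCore p G)).ge trivial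
  refine ⟨n, Subgroup.mem_centralizer_iff.2 fun v hv => ?_⟩
  exact commute_of_commRight_iterate_eq_one hnorm
    (fun _ => coprime_orderOf_of_mem isPGroup_pCore hn) hv
    (h p hp _ ⟨_, isPGroup_pCore, v, hv, _, hnorm, hn, rfl⟩)

theorem isNilpotent_of_forall_isCoprimeEngelCommutator
    (h : ∀ q : ℕ, q.Prime → ∀ x : G, IsCoprimeEngelCommutator (m + 1) q x → x = 1) :
    Group.IsNilpotent G := by
  induction hn : Nat.card G using Nat.strong_induction_on generalizing G with
  | _ n ih =>
    subst hn
    cases subsingleton_or_nontrivial G with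
    | inl _ => infer_instance
    | inr _ =>
      have := (Subgroup.nontrivial_iff_ne_bot _).2
        (center_ne_bot_of_forall_isCoprimeEngelCommutator h)
      have hlt : Nat.card (G ⧸ Subgroup.center G) < Nat.card G := by
        rw [Subgroup.card_eq_card_quotient_mul_card_subgroup (Subgroup.center G)]
        exact lt_mul_of_one_lt_right Nat.card_pos Finite.one_lt_card
      refine Group.of_quotient_center_nilpotent (ih _ hlt (fun q hq x hx => ?_) rfl)
      have := Fact.mk hq
      obtain ⟨y, hy, rfl⟩ := hx.exists_map_eq (QuotientGroup.mk'_surjective (Subgroup.center G))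
      rw [h q hq y hy, map_one]

end NilpotencyCriterion

theorem GammaStarOrdersMultiply.isNilpotent_quotient_fittingSubgroup {G : Type*} [Group G]
    [Finite G] [Group.IsSolvable G] {m : ℕ} (h : GammaStarOrdersMultiply (m + 2) G) :
    Group.IsNilpotent (G ⧸ fittingSubgroup G) :=
  isNilpotent_of_forall_isCoprimeEngelCommutator fun _ hq _ hx =>
    have := Fact.mk hq
    h.eq_one_of_quotient_fittingSubgroup hx

theorem mainTheorem4 (G : Type*) [Group G] [Finite G] [Group.IsSolvable G] (k : ℕ) (hk : 2 ≤ k)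
    (h : ∀ a b : G, IsGammaStarCommutator k a → IsGammaStarCommutator k b →
      (orderOf a).Coprime (orderOf b) → orderOf (a * b) = orderOf a * orderOf b) :
    Group.IsNilpotent (gammaStar G k) ∧ IsMetanilpotent G ∧ fittingHeight G ≤ 2 := by
  obtain ⟨m, rfl⟩ := Nat.exists_eq_add_of_le' hk
  have hquot : Group.IsNilpotent (G ⧸ fittingSubgroup G) :=
    GammaStarOrdersMultiply.isNilpotent_quotient_fittingSubgroup h
  have hmeta : IsMetanilpotent G := ⟨fittingSubgroup G, inferInstance, inferInstance, hquot⟩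
  exact ⟨isNilpotent_of_le (gammaStar_le_of_isNilpotent_quotient (fittingSubgroup G) m), hmeta,
    hmeta.fittingHeight_le_two⟩
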